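/- Let $F_2$ be the free group of rank two. A basis of $F_2$ is an ordered pair $(a,b)$ of free generators, and an element is primitive if it is a member of a basis. An element $w=w(a,b)$ is palindromic in $(a,b)$ if $w(a,b)^{-1}=w(a^{-1},b^{-1})$. Let $W=\langle p,q,r\mid p^2=q^2=r^2=1\rangle$. For a basis $e=(a,b)$ put $c=(ab)^{-1}$ and let $\psi_e:F_2\to W$ be the homomorphism with $\psi_e(a)=qr$ and $\psi_e(b)=rp$ (so $\psi_e(c)=pq$). An element of $\mathrm{PSL}(2,\mathbb C)$ is loxodromic if the trace of its lifts to $\mathrm{SL}(2,\mathbb C)$ is not in $[-2,2]$. The axis $\mathrm{Axis}_X\subset\mathbb H^3$ of an elliptic or loxodromic $X\in\mathrm{PSL}(2,\mathbb C)$ is the geodesic line whose ideal end points are the two fixed points of $X$ in $\mathrm P^1(\mathbb C)$. A representation $\rho:F_2\to\mathrm{PSL}(2,\mathbb C)$ is irreducible if it has no fixed point in $\mathrm P^1(\mathbb C)$. It has the bounded intersection property with respect to $e=(a,b)$ if (i) $\rho$ is irreducible; (ii) $\rho(w)$ is loxodromic for every primitive $w$; (iii) for the Coxeter extension $\rho_e:W\to\mathrm{PSL}(2,\mathbb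 C)$ of $\rho$, that is, the homomorphism with $\rho_e\circ\psi_e=\rho$ (which exists and is unique under (i) and (ii)), with $P=\rho_e(p)$, $Q=\rho_e(q)$, $R=\rho_e(r)$, the following three sets are bounded in $\mathbb H^3$: $J_P$, $J_Q$ and $J_R$, where $J_P$ is the set of the intersection points of $\mathrm{Axis}_P$ with the axes $\mathrm{Axis}_{\rho(w)}$ for $w$ primitive and palindromic in $(b,c)$; $J_Q$ is the same with $\mathrm{Axis}_Q$ and $(c,a)$; and $J_R$ is the same with $\mathrm{Axis}_R$ and $(a,b)$. Let $\mathcal X(F_2)$ be the character variety, the GIT quotient of $\mathrm{Hom}(F_2,\mathrm{PSL}(2,\mathbb C))$ by conjugation in $\mathrm{PSL}(2,\mathbb C)$, with the action of $\mathrm{Out}(F_2)=\mathrm{Aut}(F_2)/\mathrm{Inn}(F_2)$ induced by $\varphi\cdot\rho=\rho\circ\varphi^{-1}$. For a basis $e$, let $\mathcal{BI}\subset\mathcal X(F_2)$ be the set of the classes of the representations that have the bounded intersection property with respect to $e$. **Proposition.** The bounded intersection property does not depend on the basis: for every representation $\rho:F_2\to\mathrm{PSL}(2,\mathbb C)$ and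 all bases $e,f$ of $F_2$, $\rho$ has the bounded intersection property with respect to $e$ if and only if it has it with respect to $f$. Consequently, the set $\mathcal{BI}$ is invariant under the action of $\mathrm{Out}(F_2)$: $\theta\cdot\mathcal{BI}=\mathcal{BI}$ for every $\theta\in\mathrm{Out}(F_2)$. -/

import Mathlib

open scoped LinearAlgebra.Projectivization

noncomputable section

namespace BoundedIntersection

/-! ### The free group of rank two -/

/-- The free group of rank two. -/
abbrev F2 : Type := FreeGroup (Fin 2)

/-- A basis of `F2`: an ordered pair `(e 0, e 1)` of free generators. -/
abbrev F2Basis : Type := FreeGroupBasis (Fin 2) F2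

/-- An element of `F2` is primitive if it is a member of a basis. -/
def IsPrimitive (w : F2) : Prop := ∃ (e : F2Basis) (i : Fin 2), e i = w

/-- The third member `c = (ab)⁻¹` of the basic triple `(a, b, c)`, `abc = 1`, of a basis
`(a, b)`. -/
def third (e : F2Basis) : F2 := (e 0 * e 1)⁻¹

/-- `w` is palindromic in `(x, y)`: it is written as a word `v(x, y)` with
`v(x, y)⁻¹ = v(x⁻¹, y⁻¹)`. -/
def IsPalindromeIn (x y w : F2) : Prop :=
  ∃ v : FreeGroup (Fin 2),
    FreeGroup.lift ![x, y] v = w ∧ w⁻¹ = FreeGroup.lift ![x⁻¹, y⁻¹] v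

/-! ### The free Coxeter group of rank three -/

/-- The relators `p²`, `q²`, `r²`. -/
def coxeterRels : Set (FreeGroup (Fin 3)) := Set.range fun i => FreeGroup.of i ^ 2

/-- The free Coxeter group `W = ⟨p, q, r ∣ p² = q² = r² = 1⟩`. -/
abbrev W : Type := PresentedGroup coxeterRels

/-- The three generators of `W`: `p = gen 0`, `q = gen 1`, `r = gen 2`. -/
def gen (i : Fin 3) : W := PresentedGroup.of i

/-- The embedding `ψ : F2 → W` attached to a basis `(a, b)`, with `ψ a = q r`, `ψ b = r p`
(hence `ψ c = p q`). -/
def psi (e : F2Basis) : F2 →* W := e.lift ![gen 1 * gen 2, gen 2 * gen 0]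

/-! ### `PSL(2, ℂ)` and hyperbolic three-space -/

abbrev PSL2C : Type := Matrix.ProjectiveSpecialLinearGroup (Fin 2) ℂ

/-- The projective line `P¹(ℂ)`, the ideal boundary of hyperbolic three-space. The class of
`![z, 1]` is the point `z ∈ ℂ`, and that of `![1, 0]` is `∞`. -/
abbrev P1 : Type := ℙ ℂ (Fin 2 → ℂ)

/-- `X` is loxodromic: the trace of its lifts to `SL(2, ℂ)` is not in `[-2, 2]`. -/
def IsLoxodromic (X : PSL2C) : Prop :=
  ∀ A : Matrix.SpecialLinearGroup (Fin 2) ℂ, (A : PSL2C) = X →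
    ¬ ∃ r : ℝ, r ∈ Set.Icc (-2 : ℝ) 2 ∧ (A : Matrix (Fin 2) (Fin 2) ℂ).trace = (r : ℂ)

/-- The upper half-space `ℂ × ℝ⁺`. -/
structure H3 where
  z : ℂ
  t : ℝ
  t_pos : 0 < t

/-- The hyperbolic distance of the upper half-space:
`cosh d(p, q) = 1 + (|p.z - q.z|² + (p.t - q.t)²) / (2 p.t q.t)`. -/
def H3.hdist (p q : H3) : ℝ :=
  Real.arcosh (1 + (‖p.z - q.z‖ ^ 2 + (p.t - q.t) ^ 2) / (2 * p.t * q.t))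

/-- A subset of hyperbolic three-space is bounded. -/
def HBounded (J : Set H3) : Prop := ∃ C : ℝ, ∀ p ∈ J, ∀ q ∈ J, H3.hdist p q ≤ C

/-- The geodesic line of the upper half-space with ideal end points `u ≠ v` in `P¹(ℂ)`, in
homogeneous coordinates. If `u = ∞` and `v ∈ ℂ`, the equation says `z = v`: the vertical half-line
over `v`. If `u, v ∈ ℂ`, it says `(u - z) * conj (v - z) = - t²`: `z` lies on the segment from `u`
to `v` and `|z - u| |z - v| = t²`, the half-circle over the segment, orthogonal to `ℂ`. -/
def geodesicLine (u v : P1) : Set H3 :=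
  {x | (u.rep 0 - x.z * u.rep 1) * (starRingEnd ℂ) (v.rep 0 - x.z * v.rep 1)
      + (x.t : ℂ) ^ 2 * (u.rep 1 * (starRingEnd ℂ) (v.rep 1)) = 0}

/-- The axis of an elliptic or loxodromic isometry `X` (which has exactly two fixed points in
`P¹(ℂ)`): the geodesic line whose ideal end points are the fixed points of `X`. -/
def axis (X : PSL2C) : Set H3 :=
  {x | ∃ u v : P1, u ≠ v ∧ X • u = u ∧ X • v = v ∧ x ∈ geodesicLine u v}

/-! ### The bounded intersection property -/

/-- A representation is irreducible if it has no fixed point in `P¹(ℂ)`. -/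
def IsIrreducible (ρ : F2 →* PSL2C) : Prop := ¬ ∃ u : P1, ∀ w : F2, ρ w • u = u

/-- The set of the intersections of the axis of `X` with the axes of `ρ w`, where `w` runs through
the primitive elements that are palindromic in `(x, y)`. -/
def intersectionSet (ρ : F2 →* PSL2C) (X : PSL2C) (x y : F2) : Set H3 :=
  {s | ∃ w : F2, IsPrimitive w ∧ IsPalindromeIn x y w ∧ s ∈ axis X ∩ axis (ρ w)}

/-- `ρ` has the bounded intersection property with respect to the basis `e = (a, b)`: it is
irreducible, sends all primitive elements to loxodromic elements, and, for its Coxeter extension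
`ρe : W → PSL(2, ℂ)` (which, given the first two conditions, exists and is unique) with `P, Q, R`
the images of `p, q, r`, the sets `J_P`, `J_Q` and `J_R` are bounded. -/
def HasBoundedIntersection (ρ : F2 →* PSL2C) (e : F2Basis) : Prop :=
  IsIrreducible ρ ∧
  (∀ w : F2, IsPrimitive w → IsLoxodromic (ρ w)) ∧
  ∃ ρe : W →* PSL2C, ρe.comp (psi e) = ρ ∧
    HBounded (intersectionSet ρ (ρe (gen 0)) (e 1) (third e)) ∧
    HBounded (intersectionSet ρ (ρe (gen 1)) (third e) (e 0)) ∧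
    HBounded (intersectionSet ρ (ρe (gen 2)) (e 0) (e 1))

/-! ### The character variety and the action of `Out(F2)` -/

/-- The matrix coefficient `ρ ↦ A i j * A k l` on `Hom(F2, PSL(2, ℂ))`, where `A` is a lift of
`ρ w` to `SL(2, ℂ)`; the product does not depend on the lift `± A`. -/
def matrixCoeff (w : F2) (i j k l : Fin 2) (ρ : F2 →* PSL2C) : ℂ :=
  (Quotient.out (ρ w) : Matrix.SpecialLinearGroup (Fin 2) ℂ) i j *
    (Quotient.out (ρ w) : Matrix.SpecialLinearGroup (Fin 2) ℂ) k l

/-- The coordinate ring of the affine variety `Hom(F2, PSL(2, ℂ))`: the algebra of functions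
generated by the matrix coefficients (the coordinate ring of `PSL(2, ℂ)` is generated by the
products of two matrix entries). -/
def coordinateRing : Subalgebra ℂ ((F2 →* PSL2C) → ℂ) :=
  Algebra.adjoin ℂ {f | ∃ w i j k l, f = matrixCoeff w i j k l}

/-- The representation `x ↦ h * ρ x * h⁻¹`. -/
def conjRep (h : PSL2C) (ρ : F2 →* PSL2C) : F2 →* PSL2C := (MulAut.conj h).toMonoidHom.comp ρ

/-- A function on `Hom(F2, PSL(2, ℂ))` is an invariant if it is regular and invariant under
conjugation in `PSL(2, ℂ)`. -/
def IsInvariant (f : (F2 →* PSL2C) → ℂ) : Prop :=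
  f ∈ coordinateRing ∧ ∀ (h : PSL2C) (ρ : F2 →* PSL2C), f (conjRep h ρ) = f ρ

/-- Two representations give the same point of the GIT quotient if no regular invariant separates
them. -/
def gitSetoid : Setoid (F2 →* PSL2C) where
  r ρ ρ' := ∀ f, IsInvariant f → f ρ = f ρ'
  iseqv := ⟨fun _ _ _ => rfl, fun h f hf => (h f hf).symm,
    fun h h' f hf => (h f hf).trans (h' f hf)⟩

/-- The set of points of the character variety, the GIT quotient of `Hom(F2, PSL(2, ℂ))` by
conjugation in `PSL(2, ℂ)`. -/
def CharacterVariety : Type := Quotient gitSetoid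

/-- The character of a representation. -/
def character (ρ : F2 →* PSL2C) : CharacterVariety := Quotient.mk gitSetoid ρ

/-- The action of an automorphism on representations, `φ · ρ = ρ ∘ φ⁻¹`. -/
def autRep (φ : MulAut F2) (ρ : F2 →* PSL2C) : F2 →* PSL2C := ρ.comp (φ⁻¹).toMonoidHom

lemma coordinateRing_comp_autRep (φ : MulAut F2) {f : (F2 →* PSL2C) → ℂ}
    (hf : f ∈ coordinateRing) : (fun ρ => f (autRep φ ρ)) ∈ coordinateRing := by
  induction hf using Algebra.adjoin_induction with
  | mem f hf =>
    obtain ⟨w, i, j, k, l, rfl⟩ := hf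
    exact Algebra.subset_adjoin ⟨φ⁻¹ w, i, j, k, l, rfl⟩
  | algebraMap c => exact Subalgebra.algebraMap_mem _ c
  | add f g _ _ h₁ h₂ => exact add_mem h₁ h₂
  | mul f g _ _ h₁ h₂ => exact mul_mem h₁ h₂

lemma gitSetoid_autRep (φ : MulAut F2) {ρ ρ' : F2 →* PSL2C} (h : gitSetoid.r ρ ρ') :
    gitSetoid.r (autRep φ ρ) (autRep φ ρ') := fun f hf =>
  h (fun σ => f (autRep φ σ))
    ⟨coordinateRing_comp_autRep φ hf.1, fun g σ => hf.2 g (autRep φ σ)⟩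

/-- The action of `Aut(F2)` on the character variety. -/
instance : MulAction (MulAut F2) CharacterVariety where
  smul φ := Quotient.map (autRep φ) fun _ _ h => gitSetoid_autRep φ h
  one_smul χ := by
    induction χ using Quotient.inductionOn with
    | h ρ => rfl
  mul_smul φ φ' χ := by
    induction χ using Quotient.inductionOn with
    | h ρ =>
      refine congrArg (Quotient.mk gitSetoid) (MonoidHom.ext fun w => ?_)
      change ρ ((φ * φ')⁻¹ w) = ρ (φ'⁻¹ (φ⁻¹ w))
      rw [mul_inv_rev]
      rfl

/-- The subgroup of inner automorphisms. -/
def Inn : Subgroup (MulAut F2) := (MulAut.conj : F2 →* MulAut F2).range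

instance : Inn.Normal where
  conj_mem := by
    rintro _ ⟨g, rfl⟩ φ
    refine ⟨φ g, MulEquiv.ext fun w => ?_⟩
    change φ g * w * (φ g)⁻¹ = φ (g * φ⁻¹ w * g⁻¹)
    rw [map_mul, map_mul, map_inv, MulAut.apply_inv_self]

/-- The outer automorphism group of `F2`. -/
abbrev OutF2 : Type := MulAut F2 ⧸ Inn

lemma inn_le_ker : Inn ≤ (MulAction.toPermHom (MulAut F2) CharacterVariety).ker := by
  rintro _ ⟨g, rfl⟩
  refine Equiv.ext fun χ => ?_
  induction χ using Quotient.inductionOn with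
  | h ρ =>
    refine Quotient.sound (s := gitSetoid) fun f hf => ?_
    rw [← hf.2 (ρ g)⁻¹ ρ]
    refine congrArg f (MonoidHom.ext fun w => ?_)
    change ρ ((MulAut.conj g)⁻¹ w) = (ρ g)⁻¹ * ρ w * ((ρ g)⁻¹)⁻¹
    rw [MulAut.conj_inv_apply, map_mul, map_mul, map_inv, inv_inv]

/-- The action of `Out(F2)` on the character variety, induced by that of `Aut(F2)`. -/
instance : MulAction OutF2 CharacterVariety :=
  MulAction.compHom _ (QuotientGroup.lift Inn (MulAction.toPermHom (MulAut F2) CharacterVariety)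
    inn_le_ker)

/-- The set of the characters of the representations that have the bounded intersection property
with respect to `e`. -/
def BI (e : F2Basis) : Set CharacterVariety :=
  {χ | ∃ ρ : F2 →* PSL2C, HasBoundedIntersection ρ e ∧ character ρ = χ}

end BoundedIntersection

end

/-! Inside the Coxeter group W, conjugation by p, q and r restricts to the three involutions `invP`,
`invQ`, `invR` of F2, and an element is palindromic in (a, b) exactly when `invR` inverts it;
likewise for the other two pairs (`intersectionSet_eq`). The property thus becomes a statement about
a triple (P, Q, R) of elements of order at most two with ρ(a) = QR, ρ(b) = RP, and about primitive
elements inverted by the matching involutions (`hasBoundedIntersection_iff`).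

A Nielsen move replaces the triple by (RQR, RPR, R), (P, RQR, R) or (P, QRQ, Q). Each new member is
an old one or its conjugate by Q or R. Conjugation by Q or R is induced by an automorphism of F2,
which permutes the primitive elements, and the isometry it defines carries axes to axes. Hence each
new set J is an old one or lies in an isometric image of one, and stays bounded
(`HBounded.invertedSet_conj`).

Every generating pair of F2 arises from the standard one by Nielsen moves and conjugations
(`NielsenClosed.of_generatesPair`, by induction on total length), so the property spreads from the
standard basis to all others. Transport by automorphisms (`HasBoundedIntersection.autRep`) reduces
an arbitrary starting basis to the standard one and also gives the invariance under Out(F2). -/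

noncomputable section

namespace BoundedIntersection

/-! ### Common prefixes of reduced words -/

section CommonPrefix

variable {α : Type*} [DecidableEq α]

/-- The length of the longest common prefix of two lists. -/
def commonPrefix : List α → List α → ℕ
  | a :: l, b :: m => if a = b then commonPrefix l m + 1 else 0
  | _, _ => 0

lemma commonPrefix_comm (l m : List α) : commonPrefix l m = commonPrefix m l := by
  induction l generalizing m with
  | nil => cases m <;> simp [commonPrefix]
  | cons a l ih =>
    cases m with
    | nil => simp [commonPrefix]
    | cons b m => simp [commonPrefix, ih m, eq_comm]

lemma min_commonPrefix_le (l m n : List α) :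
    min (commonPrefix l m) (commonPrefix m n) ≤ commonPrefix l n := by
  induction l generalizing m n with
  | nil => cases m <;> simp [commonPrefix]
  | cons a l ih =>
    cases m with
    | nil => simp [commonPrefix]
    | cons b m =>
      cases n with
      | nil => simp [commonPrefix]
      | cons c n =>
        have := ih m n
        simp only [commonPrefix]
        split_ifs <;> first | omega | simp_all

lemma getElem?_eq_of_lt_commonPrefix {l m : List α} {i : ℕ} (h : i < commonPrefix l m) :
    l[i]? = m[i]? := by
  induction l generalizing m i with
  | nil => cases m <;> simp [commonPrefix] at h
  | cons a l ih =>
    cases m with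
    | nil => simp [commonPrefix] at h
    | cons b m =>
      simp only [commonPrefix] at h
      split_ifs at h with hab
      · cases i with
        | zero => simp [hab]
        | succ i => simpa using ih (by omega)
      · omega

lemma take_eq_of_le_commonPrefix {l m : List α} {k : ℕ} (h : k ≤ commonPrefix l m) :
    l.take k = m.take k := by
  refine List.ext_getElem? fun i => ?_
  rw [List.getElem?_take, List.getElem?_take]
  split_ifs with hi
  · exact getElem?_eq_of_lt_commonPrefix (hi.trans_le h)
  · rfl

end CommonPrefix

/-! ### The Gromov product on a free group -/

section GromovProduct

open FreeGroup

variable {α : Type*} [DecidableEq α]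

/-- The Gromov product of two elements of a free group with respect to the identity. -/
def gromov (g h : FreeGroup α) : ℕ := commonPrefix g.toWord h.toWord

lemma gromov_comm (g h : FreeGroup α) : gromov g h = gromov h g := commonPrefix_comm _ _

lemma min_gromov_le (g h k : FreeGroup α) : min (gromov g h) (gromov h k) ≤ gromov g k :=
  min_commonPrefix_le _ _ _

/-- Cancellation in l⁻¹m removes exactly the common prefix of l and m, once from each factor; after
the first differing letter the concatenation is reduced. -/
lemma norm_mk_invRev_append {l m : List (α × Bool)} (hl : IsReduced l) (hm : IsReduced m) :
    (mk (invRev l ++ m)).norm + 2 * commonPrefix l m = l.length + m.length := by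
  induction l generalizing m with
  | nil => cases m <;> simp [commonPrefix, FreeGroup.norm, hm.reduce_eq]
  | cons a l ih =>
    cases m with
    | nil =>
      have : (mk (a :: l)).norm = (a :: l).length := by simp [FreeGroup.norm, hl.reduce_eq]
      rw [List.append_nil, ← inv_mk, norm_inv_eq, this]
      simp [commonPrefix]
    | cons b m =>
      simp only [commonPrefix]
      split_ifs with hab
      · subst hab
        have h1 : mk (invRev (a :: l) ++ a :: m) = mk (invRev l ++ m) := by
          rw [← mul_mk, ← mul_mk, ← inv_mk, ← inv_mk, ← List.singleton_append (l := l),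
            ← List.singleton_append (l := m), ← mul_mk, ← mul_mk]
          group
        have h2 := ih (m := m) hl.tail hm.tail
        rw [h1]
        simp only [List.length_cons]
        omega
      · have h1 : IsReduced (invRev (a :: l) ++ b :: m) := by
          have h3 : IsReduced (invRev (a :: l)) := by
            have := isReduced_toWord (x := (mk (a :: l))⁻¹)
            rwa [toWord_inv, toWord_mk, hl.reduce_eq] at this
          rw [invRev_cons] at h3 ⊢
          refine List.IsChain.append_overlap (l₂ := invRev [a]) h3 ?_ (by simp [invRev])
          simp only [invRev, List.map_cons, List.map_nil, List.reverse_singleton,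
            List.singleton_append]
          refine List.IsChain.cons_cons ?_ hm
          intro h4
          obtain ⟨a1, a2⟩ := a
          obtain ⟨b1, b2⟩ := b
          simp only at h4 ⊢
          subst h4
          cases a2 <;> cases b2 <;> simp_all
        rw [FreeGroup.norm, toWord_mk, h1.reduce_eq]
        simp

lemma norm_inv_mul_add_gromov (g h : FreeGroup α) :
    (g⁻¹ * h).norm + 2 * gromov g h = g.norm + h.norm := by
  have := norm_mk_invRev_append (isReduced_toWord (x := g)) (isReduced_toWord (x := h))
  rwa [← mul_mk, ← inv_mk, mk_toWord, mk_toWord] at this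

lemma norm_mul_add_gromov (g h : FreeGroup α) :
    (g * h).norm + 2 * gromov g⁻¹ h = g.norm + h.norm := by
  simpa using norm_inv_mul_add_gromov g⁻¹ h

/-- The part of g that survives in gh is precisely the prefix that gh shares with g. -/
lemma gromov_mul_self_add (g h : FreeGroup α) :
    gromov (g * h) g + gromov g⁻¹ h = g.norm := by
  have h1 := norm_inv_mul_add_gromov (g * h) g
  have h2 := norm_mul_add_gromov g h
  rw [show (g * h)⁻¹ * g = h⁻¹ by group, norm_inv_eq] at h1
  omega

/-- Otherwise letters at mirror positions of g would be mutually inverse up to the middle: for even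
length two adjacent letters would cancel, for odd length the middle letter would be its own inverse.
-/
lemma two_mul_gromov_inv_self_lt {g : FreeGroup α} (hg : g ≠ 1) :
    2 * gromov g⁻¹ g < g.norm := by
  by_contra! h
  have hpos : 0 < g.norm := Nat.pos_of_ne_zero (by simpa using hg)
  have hkey : ∀ i, i < gromov g⁻¹ g → ∀ (h1 : i < g.toWord.length)
      (h2 : g.toWord.length - 1 - i < g.toWord.length),
      (g.toWord[i]).1 = (g.toWord[g.toWord.length - 1 - i]).1 ∧
        (g.toWord[i]).2 = !(g.toWord[g.toWord.length - 1 - i]).2 := by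
    intro i hi h1 h2
    have h3 := getElem?_eq_of_lt_commonPrefix hi
    rw [toWord_inv, invRev, List.getElem?_reverse (by simpa using h1), List.length_map,
      List.getElem?_map, List.getElem?_eq_getElem h2, List.getElem?_eq_getElem h1] at h3
    simp only [Option.map_some, Option.some.injEq] at h3
    rw [← h3]
    simp
  have hn : g.norm = g.toWord.length := rfl
  rcases Nat.even_or_odd' g.toWord.length with ⟨j, hj | hj⟩
  · have h3 := hkey (j - 1) (by omega) (by omega) (by omega)
    have h4 := List.isChain_iff_getElem.1 (isReduced_toWord (x := g)) (j - 1) (by omega)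
    have h5 : g.toWord.length - 1 - (j - 1) = j - 1 + 1 := by omega
    simp only [h5] at h3
    have := h4 h3.1
    rw [h3.2] at this
    simp at this
  · have h3 := (hkey j (by omega) (by omega) (by omega)).2
    have h5 : g.toWord.length - 1 - j = j := by omega
    simp only [h5] at h3
    simp at h3

/-- The prefix of length `k` of an element of a free group. -/
def wordPrefix (k : ℕ) (g : FreeGroup α) : FreeGroup α := mk (g.toWord.take k)

lemma norm_wordPrefix_le (k : ℕ) (g : FreeGroup α) : (wordPrefix k g).norm ≤ k :=
  norm_mk_le.trans (by simp)

lemma wordPrefix_eq_of_le_gromov {k : ℕ} {g h : FreeGroup α} (hk : k ≤ gromov g h) :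
    wordPrefix k g = wordPrefix k h := by
  rw [wordPrefix, take_eq_of_le_commonPrefix hk, wordPrefix]

/-- The last k letters of g are the inverse of the first k letters of g⁻¹, and `hk` keeps the two
ends from overlapping. -/
lemma exists_eq_wordPrefix_mul (k : ℕ) (g : FreeGroup α) (hk : 2 * k ≤ g.norm) :
    ∃ m : FreeGroup α, g = wordPrefix k g * m * (wordPrefix k g⁻¹)⁻¹ ∧
      m.norm + 2 * k ≤ g.norm := by
  have hn : g.norm = g.toWord.length := rfl
  refine ⟨mk ((g.toWord.drop k).take (g.toWord.length - 2 * k)), ?_, ?_⟩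
  · have h1 : invRev (g⁻¹.toWord.take k) =
        (g.toWord.drop k).drop (g.toWord.length - 2 * k) := by
      rw [toWord_inv, invRev, invRev, List.drop_drop, List.take_reverse, List.map_reverse,
        List.reverse_reverse, List.map_drop, List.map_map, List.length_map]
      simp only [Function.comp_def, Bool.not_not, Prod.mk.eta, List.map_id']
      congr 1
      omega
    rw [wordPrefix, wordPrefix, inv_mk, h1, mul_mk, mul_mk, List.append_assoc,
      List.take_append_drop, List.take_append_drop, mk_toWord]
  · have := norm_mk_le (L₁ := (g.toWord.drop k).take (g.toWord.length - 2 * k))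
    rw [List.length_take, List.length_drop] at this
    omega

end GromovProduct

/-! ### Nielsen reduction in a free group of rank two -/

section Nielsen

open FreeGroup

/-- The value of a letter of the alphabet `x₀, x₀⁻¹, x₁, x₁⁻¹` under `xᵢ ↦ g i`. -/
def letter {ι G : Type*} [Group G] (g : ι → G) (s : ι × Bool) : G := cond s.2 (g s.1) (g s.1)⁻¹

/-- The inverse letter. -/
def invLetter {ι : Type*} (s : ι × Bool) : ι × Bool := (s.1, !s.2)

lemma letter_invLetter {ι G : Type*} [Group G] (g : ι → G) (s : ι × Bool) :
    letter g (invLetter s) = (letter g s)⁻¹ := by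
  obtain ⟨i, b⟩ := s
  cases b <;> simp [letter, invLetter]

lemma eq_or_eq_invLetter {ι : Type*} {s t : ι × Bool} (h : s.1 = t.1) :
    t = s ∨ t = invLetter s := by
  obtain ⟨i, b⟩ := s
  obtain ⟨j, c⟩ := t
  cases b <;> cases c <;> simp_all [invLetter]

lemma norm_letter {ι α : Type*} [DecidableEq α] (g : ι → FreeGroup α) (s : ι × Bool) :
    (letter g s).norm = (g s.1).norm := by
  obtain ⟨i, b⟩ := s
  cases b <;> simp [letter]

/-- In a product of a reduced word in a Nielsen reduced system, no letter cancels completely. -/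
lemma norm_letter_le_norm_prod {ι α : Type*} [DecidableEq α] (g : ι → FreeGroup α)
    (h1 : ∀ s t : ι × Bool, s ≠ t → 2 * gromov (letter g s) (letter g t) ≤ (letter g t).norm)
    (h2 : ∀ s t r : ι × Bool, s ≠ t → r ≠ invLetter t →
      gromov (letter g s) (letter g t) + gromov (letter g t)⁻¹ (letter g r) < (letter g t).norm)
    (s : ι × Bool) (l : List (ι × Bool)) (hl : IsReduced (s :: l)) :
    (∀ x ∈ s :: l, (letter g x).norm ≤ ((s :: l).map (letter g)).prod.norm) ∧
      ∀ t, t ≠ s → gromov ((s :: l).map (letter g)).prod (letter g t) =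
        gromov (letter g s) (letter g t) := by
  -- The second conjunct drives the induction: it says that the cancellation between a letter and
  -- the rest of the word is already decided by the next letter. By `h1` this costs at most half of
  -- either, so the product is no shorter than its factors.
  induction l generalizing s with
  | nil => simp
  | cons s' l ih =>
    obtain ⟨ih1, ih2⟩ := ih s' hl.tail
    have hs' : s' ≠ invLetter s := by
      rintro rfl
      have : IsReduced (s :: invLetter s :: l) := hl
      rw [isReduced_cons_cons] at this
      simp [invLetter] at this
    rw [List.map_cons, List.prod_cons]
    set x := letter g s
    set w := ((s' :: l).map (letter g)).prod
    have h3 : gromov x⁻¹ w = gromov x⁻¹ (letter g s') := by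
      rw [gromov_comm, ← letter_invLetter, ih2 _ hs'.symm, gromov_comm]
    have h4 := norm_mul_add_gromov x w
    have h5 : 2 * gromov x⁻¹ (letter g s') ≤ (letter g s').norm := by
      rw [← letter_invLetter]
      exact h1 _ _ hs'.symm
    have h6 : 2 * gromov x⁻¹ (letter g s') ≤ x.norm := by
      have := h1 _ _ hs'
      rwa [letter_invLetter, norm_inv_eq, gromov_comm] at this
    have h7 := ih1 s' (by simp)
    refine ⟨fun y hy => ?_, fun t ht => ?_⟩
    · rcases List.mem_cons.1 hy with rfl | hy
      · change x.norm ≤ _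
        omega
      · have := ih1 y hy
        omega
    -- By `h2` the prefix of x surviving in xw is longer than the overlap of x with t, so the
    -- ultrametric inequality gives xw and x the same overlap with t.
    · have h8 := gromov_mul_self_add x w
      have h9 := h2 t s s' ht hs'
      change gromov (letter g t) x + gromov x⁻¹ (letter g s') < x.norm at h9
      have h10 := min_gromov_le (x * w) x (letter g t)
      have h11 := min_gromov_le x (x * w) (letter g t)
      rw [gromov_comm (letter g t)] at h9
      rw [gromov_comm x] at h11
      omega

/-- The two free generators of `F2` are not both contained in a cyclic subgroup. -/
lemma not_of_mem_zpowers (z : F2) :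
    ¬ ∀ i : Fin 2, (of i : F2) ∈ Subgroup.zpowers z := by
  intro h
  obtain ⟨m, hm⟩ := Subgroup.mem_zpowers_iff.1 (h 0)
  obtain ⟨n, hn⟩ := Subgroup.mem_zpowers_iff.1 (h 1)
  have h1 : (of 0 : F2) * of 1 = of 1 * of 0 := by
    rw [← hm, ← hn]
    exact (Commute.refl z).zpow_zpow m n
  -- Two transpositions of three points that do not commute.
  have h2 := congrArg (FreeGroup.lift ![Equiv.swap (0 : Fin 3) 1, Equiv.swap (1 : Fin 3) 2]) h1
  simp only [_root_.map_mul, lift_apply_of] at h2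
  revert h2
  decide

/-- The pair `(u, v)` generates the group. -/
def GeneratesPair {G : Type*} [Group G] (u v : G) : Prop :=
  ∀ N : Subgroup G, u ∈ N → v ∈ N → N = ⊤

lemma GeneratesPair.not_zpowers {u v z : F2} (h : GeneratesPair u v)
    (hu : u ∈ Subgroup.zpowers z) (hv : v ∈ Subgroup.zpowers z) : False :=
  not_of_mem_zpowers z fun i => by rw [h _ hu hv]; trivial

lemma GeneratesPair.of_mem {G : Type*} [Group G] {u v x y : G} (h : GeneratesPair u v)
    (hx : ∀ N : Subgroup G, x ∈ N → y ∈ N → u ∈ N ∧ v ∈ N) : GeneratesPair x y :=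
  fun N h1 h2 => h N (hx N h1 h2).1 (hx N h1 h2).2

/-- A relation between two elements that is stable under the Nielsen moves and under simultaneous
conjugation. -/
structure NielsenClosed {G : Type*} [Group G] (C : G → G → Prop) : Prop where
  swap : ∀ u v, C u v → C v u
  inv : ∀ u v, C u v → C u⁻¹ v
  mul : ∀ u v, C u v → C u (u * v)
  conj : ∀ g u v, C u v → C (g * u * g⁻¹) (g * v * g⁻¹)

lemma NielsenClosed.inv_right {G : Type*} [Group G] {C : G → G → Prop} (hC : NielsenClosed C)
    {u v : G} (h : C u v) : C u v⁻¹ :=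
  hC.swap _ _ (hC.inv _ _ (hC.swap _ _ h))

lemma NielsenClosed.letter_iff {G : Type*} [Group G] {C : G → G → Prop} (hC : NielsenClosed C)
    (g : Fin 2 → G) {s t : Fin 2 × Bool} (hst : s.1 ≠ t.1) :
    C (letter g s) (letter g t) ↔ C (g 0) (g 1) := by
  have hl : ∀ u v, C u⁻¹ v ↔ C u v := fun u v =>
    ⟨fun h => by simpa using hC.inv _ _ h, hC.inv _ _⟩
  have hr : ∀ u v, C u v⁻¹ ↔ C u v := fun u v =>
    ⟨fun h => by simpa using hC.inv_right h, hC.inv_right⟩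
  have hs : C (g 1) (g 0) ↔ C (g 0) (g 1) := ⟨hC.swap _ _, hC.swap _ _⟩
  obtain ⟨i, b⟩ := s
  obtain ⟨j, c⟩ := t
  fin_cases i <;> fin_cases j <;> cases b <;> cases c <;> simp_all [letter]

lemma GeneratesPair.letter {G : Type*} [Group G] {g : Fin 2 → G} (h : GeneratesPair (g 0) (g 1))
    {s t : Fin 2 × Bool} (hst : s.1 ≠ t.1) : GeneratesPair (letter g s) (letter g t) := by
  refine h.of_mem fun N => ?_
  obtain ⟨i, b⟩ := s
  obtain ⟨j, c⟩ := t
  fin_cases i <;> fin_cases j <;> cases b <;> cases c <;>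
    simp_all [BoundedIntersection.letter]

/-- The members of a Nielsen reduced generating pair of `F2` have length one. -/
lemma norm_le_one_of_reduced {g : Fin 2 → F2} (hg : GeneratesPair (g 0) (g 1))
    (h1 : ∀ s t : Fin 2 × Bool, s ≠ t → 2 * gromov (letter g s) (letter g t) ≤ (letter g t).norm)
    (h2 : ∀ s t r : Fin 2 × Bool, s ≠ t → r ≠ invLetter t →
      gromov (letter g s) (letter g t) + gromov (letter g t)⁻¹ (letter g r) < (letter g t).norm)
    (j : Fin 2) : (g j).norm ≤ 1 := by
  by_contra! hj
  have hsurj : (FreeGroup.lift g).range = ⊤ :=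
    hg _ ⟨of 0, by simp⟩ ⟨of 1, by simp⟩
  -- In `Fin 2`, `j + 1` is the other index. A free generator has length one, so no letter of length
  -- greater than one occurs in its expression, and only powers of the other member remain.
  refine not_of_mem_zpowers (g (j + 1)) fun i => ?_
  obtain ⟨c, hc⟩ : (of i : F2) ∈ (FreeGroup.lift g).range := by rw [hsurj]; trivial
  rw [← mk_toWord (x := c), lift_mk] at hc
  change (c.toWord.map (letter g)).prod = _ at hc
  have hred := isReduced_toWord (x := c)
  rw [← hc]
  have hall : ∀ x ∈ c.toWord, (letter g x).norm ≤ 1 := by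
    rcases hw : c.toWord with _ | ⟨s, l⟩
    · simp
    · rw [hw] at hc hred
      intro x hx
      refine ((norm_letter_le_norm_prod g h1 h2 s l hred).1 x hx).trans ?_
      rw [hc, norm_of]
  refine Subgroup.list_prod_mem _ fun y hy => ?_
  obtain ⟨x, hx, rfl⟩ := List.mem_map.1 hy
  have h3 := hall x hx
  rw [norm_letter] at h3
  have h4 : x.1 = j + 1 := by
    have : x.1 ≠ j := by rintro h; rw [h] at h3; omega
    have h5 : ∀ j k : Fin 2, k ≠ j → k = j + 1 := by decide
    exact h5 j x.1 this
  obtain ⟨k, b⟩ := x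
  simp only at h4
  subst h4
  cases b <;> simp [letter]

lemma exists_letter_of_norm_eq_one {α : Type*} [DecidableEq α] {u : FreeGroup α}
    (hu : u.norm = 1) : ∃ s, u = letter of s := by
  obtain ⟨s, hs⟩ := List.length_eq_one_iff.1 hu
  refine ⟨s, ?_⟩
  rw [← mk_toWord (x := u), hs]
  obtain ⟨i, b⟩ := s
  cases b
  · simp [letter, of, inv_mk, invRev]
  · rfl

/-- All generating pairs of `F2` are obtained from the standard one by Nielsen moves and
conjugations. -/
theorem NielsenClosed.of_generatesPair {C : F2 → F2 → Prop} (hC : NielsenClosed C)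
    (h0 : C (of 0) (of 1)) (g : Fin 2 → F2) (hg : GeneratesPair (g 0) (g 1)) :
    C (g 0) (g 1) := by
  induction hn : (g 0).norm + (g 1).norm using Nat.strong_induction_on generalizing g with
  | _ n ih =>
  have hlt : ∀ u v : F2, u.norm + v.norm < n → GeneratesPair u v → C u v := fun u v h1 h2 =>
    ih _ h1 ![u, v] h2 rfl
  have hsum : ∀ s t : Fin 2 × Bool, s.1 ≠ t.1 → (letter g s).norm + (letter g t).norm = n := by
    intro s t hst
    rw [norm_letter, norm_letter, ← hn]
    revert hst
    generalize s.1 = i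
    generalize t.1 = j
    fin_cases i <;> fin_cases j <;> simp [add_comm]
  have hne : ∀ s, letter g s ≠ 1 := by
    intro s hs
    have h1 := hg.letter (s := s) (t := (s.1 + 1, true)) (by simp)
    rw [hs] at h1
    exact h1.not_zpowers (one_mem _) (Subgroup.mem_zpowers _)
  by_cases h1 : ∀ s t : Fin 2 × Bool, s ≠ t →
      2 * gromov (letter g s) (letter g t) ≤ (letter g t).norm
  swap
  · push Not at h1
    obtain ⟨t, s, hst, h1⟩ := h1
    rw [gromov_comm] at h1
    have hst1 : t.1 ≠ s.1 := by
      intro h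
      rcases eq_or_eq_invLetter h with rfl | rfl
      · exact hst rfl
      · have := two_mul_gromov_inv_self_lt (hne t)
        rw [letter_invLetter, norm_inv_eq] at h1
        omega
    have hg' := hg.letter hst1.symm
    rw [← hC.letter_iff g hst1.symm]
    -- More than half of s cancels in s⁻¹t, so replacing t by s⁻¹t shortens the pair.
    have h2 := norm_inv_mul_add_gromov (letter g s) (letter g t)
    have h3 := hsum s t hst1.symm
    have h4 : C (letter g s) ((letter g s)⁻¹ * letter g t) := by
      refine hlt _ _ ?_ (hg'.of_mem fun N hx hy => ⟨hx, ?_⟩)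
      · omega
      · simpa using N.mul_mem hx hy
    simpa using hC.mul _ _ h4
  by_cases h2 : ∀ s t r : Fin 2 × Bool, s ≠ t → r ≠ invLetter t →
      gromov (letter g s) (letter g t) + gromov (letter g t)⁻¹ (letter g r) < (letter g t).norm
  swap
  · push Not at h2
    obtain ⟨s, t, r, hst, hrt, h2⟩ := h2
    have h3 := h1 s t hst
    have h4 := h1 (invLetter t) r hrt.symm
    have h4' := h1 r (invLetter t) hrt
    rw [gromov_comm, letter_invLetter, norm_inv_eq] at h4'
    rw [letter_invLetter] at h4
    have h5 := two_mul_gromov_inv_self_lt (hne t)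
    have hst1 : s.1 ≠ t.1 := by
      intro h
      rcases eq_or_eq_invLetter h.symm with rfl | rfl
      · exact hst rfl
      · rw [letter_invLetter] at h2 h3
        omega
    have hrt1 : r.1 ≠ t.1 := by
      intro h
      rcases eq_or_eq_invLetter h.symm with rfl | rfl
      · omega
      · exact hrt rfl
    have hsr : s.1 = r.1 := by
      revert hst1 hrt1
      generalize s.1 = i
      generalize t.1 = j
      generalize r.1 = k
      revert i j k
      decide
    set x := letter g s with hx
    set y := letter g t with hy
    -- If r were s, both y⁻¹ and y would share half of their length with x, hence with each other,
    -- against `two_mul_gromov_inv_self_lt`.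
    have hr : letter g r = x⁻¹ := by
      rcases eq_or_eq_invLetter hsr with h | h
      · have := min_gromov_le y⁻¹ x y
        rw [h, ← hx] at h2 h4'
        omega
      · rw [h, letter_invLetter]
    rw [hr] at h2 h4 h4'
    have h6 := h1 t s hst.symm
    rw [gromov_comm, ← hx, ← hy] at h6
    -- Both overlaps are now exactly half of y, so y = pq⁻¹ and x = pmq⁻¹ with p, q of length at
    -- most k. Then (xy⁻¹, y) is the conjugate by p of (m, q⁻¹p), whose total length is at most that
    -- of x. Allowing conjugation replaces the usual tie-breaking order on words of equal length.
    obtain ⟨k, hk⟩ : ∃ k, k = gromov x y := ⟨_, rfl⟩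
    have hk' : gromov y⁻¹ x⁻¹ = k := by omega
    obtain ⟨m, hm, hmn⟩ := exists_eq_wordPrefix_mul k x (by omega)
    obtain ⟨m', hm', hmn'⟩ := exists_eq_wordPrefix_mul k y (by omega)
    have hm'1 : m' = 1 := norm_eq_zero.1 (by omega)
    rw [wordPrefix_eq_of_le_gromov hk.le, ← wordPrefix_eq_of_le_gromov hk'.ge] at hm
    rw [hm'1, mul_one] at hm'
    have hp := norm_wordPrefix_le k y
    have hq := norm_wordPrefix_le k y⁻¹
    generalize wordPrefix k y = p at *
    generalize wordPrefix k y⁻¹ = q at *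
    have h7 : C m (q⁻¹ * p) := by
      refine hlt _ _ ?_ fun N hN1 hN2 => ?_
      · have h8 := norm_mul_le q⁻¹ p
        rw [norm_inv_eq] at h8
        have h9 := hsum s t hst1
        rw [← hx, ← hy] at h9
        have h10 : y.norm ≠ 0 := fun h => hne t (norm_eq_zero.1 h)
        omega
      · have h8 : N.map (MulAut.conj p).toMonoidHom = ⊤ := by
          have hyN : y ∈ N.map (MulAut.conj p).toMonoidHom :=
            ⟨_, hN2, by rw [hm']; simp [mul_assoc]⟩
          have hxN : x * y⁻¹ ∈ N.map (MulAut.conj p).toMonoidHom :=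
            ⟨_, hN1, by rw [hm', hm]; simp [mul_assoc]⟩
          exact hg.letter hst1 _ (by simpa using Subgroup.mul_mem _ hxN hyN) hyN
        rw [eq_top_iff]
        intro z _
        have h9 : p * z * p⁻¹ ∈ N.map (MulAut.conj p).toMonoidHom := by rw [h8]; trivial
        obtain ⟨z', hz', hzz⟩ := h9
        have : z' = z := by simpa using hzz
        rwa [← this]
    have h8 := hC.conj p _ _ h7
    rw [show p * (q⁻¹ * p) * p⁻¹ = y by rw [hm']; group,
      show p * m * p⁻¹ = x * y⁻¹ by rw [hm', hm]; group] at h8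
    rw [← hC.letter_iff g hst1]
    have h9 := hC.mul _ _ (hC.inv _ _ (hC.swap _ _ (hC.inv _ _ h8)))
    simpa using hC.swap _ _ (hC.inv _ _ (hC.inv_right h9))
  · have h3 := norm_le_one_of_reduced hg h1 h2
    have h4 : ∀ i, (g i).norm = 1 := fun i => by
      have h5 : (g i).norm ≠ 0 := fun h => hne (i, true) (norm_eq_zero.1 h)
      have := h3 i
      omega
    obtain ⟨s, hs⟩ := exists_letter_of_norm_eq_one (h4 0)
    obtain ⟨t, ht⟩ := exists_letter_of_norm_eq_one (h4 1)
    rw [hs, ht]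
    refine (hC.letter_iff of ?_).2 h0
    intro h
    refine hg.not_zpowers (z := letter of s) (by rw [hs]; exact Subgroup.mem_zpowers _) ?_
    rcases eq_or_eq_invLetter h with rfl | rfl
    · rw [ht]; exact Subgroup.mem_zpowers _
    · rw [ht, letter_invLetter]; exact inv_mem (Subgroup.mem_zpowers _)

end Nielsen

/-! ### Isometries of the upper half-space -/

section Geometry

open Matrix ComplexConjugate

/-- The denominator in the action of `SL(2, ℂ)` on the upper half-space. -/
def H3.denom (A : SpecialLinearGroup (Fin 2) ℂ) (x : H3) : ℝ :=
  Complex.normSq (A 1 0 * x.z + A 1 1) + Complex.normSq (A 1 0) * x.t ^ 2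

lemma det_eq_one (A : SpecialLinearGroup (Fin 2) ℂ) : A 0 0 * A 1 1 - A 0 1 * A 1 0 = 1 := by
  have := A.det_coe
  rwa [det_fin_two] at this

lemma H3.denom_pos (A : SpecialLinearGroup (Fin 2) ℂ) (x : H3) : 0 < x.denom A := by
  by_cases hc : A 1 0 = 0
  · have hd : A 1 1 ≠ 0 := by
      intro h
      have := det_eq_one A
      simp [hc, h] at this
    simpa [denom, hc] using hd
  · have h1 := Complex.normSq_pos.2 hc
    have h2 := x.t_pos
    have h3 := Complex.normSq_nonneg (A 1 0 * x.z + A 1 1)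
    unfold denom
    positivity

lemma H3.ofReal_denom (A : SpecialLinearGroup (Fin 2) ℂ) (x : H3) :
    (x.denom A : ℂ) = (A 1 0 * x.z + A 1 1) * (conj (A 1 0) * conj x.z + conj (A 1 1)) +
      A 1 0 * conj (A 1 0) * x.t ^ 2 := by
  simp [denom, Complex.normSq_eq_conj_mul_self]
  ring

/-- The action of `SL(2, ℂ)` on the upper half-space. -/
def H3.move (A : SpecialLinearGroup (Fin 2) ℂ) (x : H3) : H3 where
  z := ((A 0 0 * x.z + A 0 1) * conj (A 1 0 * x.z + A 1 1) +
    A 0 0 * conj (A 1 0) * x.t ^ 2) / x.denom A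
  t := x.t / x.denom A
  t_pos := div_pos x.t_pos (x.denom_pos A)

/-- The positive definite Hermitian matrix of determinant one attached to a point of the upper
half-space. -/
def H3.herm (x : H3) : Matrix (Fin 2) (Fin 2) ℂ :=
  (x.t : ℂ)⁻¹ • !![x.z * conj x.z + x.t ^ 2, x.z; conj x.z, 1]

lemma H3.herm_move (A : SpecialLinearGroup (Fin 2) ℂ) (x : H3) :
    (x.move A).herm = (A : Matrix (Fin 2) (Fin 2) ℂ) * x.herm *
      (A : Matrix (Fin 2) (Fin 2) ℂ)ᴴ := by
  have ht : (x.t : ℂ) ≠ 0 := by exact_mod_cast x.t_pos.ne'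
  have hD : (x.denom A : ℂ) ≠ 0 := by exact_mod_cast (x.denom_pos A).ne'
  have hD' := x.ofReal_denom A
  have hdet := det_eq_one A
  have hdet' : conj (A 0 0) * conj (A 1 1) - conj (A 0 1) * conj (A 1 0) = 1 := by
    rw [← map_mul, ← map_mul, ← map_sub, hdet, map_one]
  ext i j
  fin_cases i <;> fin_cases j
  · simp [herm, move, mul_apply, Fin.sum_univ_two]
    field_simp
    rw [hD']
    linear_combination (-(x.t : ℂ) ^ 2) *
      ((conj (A 0 0) * conj (A 1 1) - conj (A 0 1) * conj (A 1 0)) * hdet + hdet')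
  · simp [herm, move, mul_apply, Fin.sum_univ_two]
    field_simp
    ring
  · simp [herm, move, mul_apply, Fin.sum_univ_two]
    field_simp
    ring
  · simp [herm, move, mul_apply, Fin.sum_univ_two]
    field_simp
    rw [hD']
    ring

/-- The value is 2 cosh d(x, y), so the distance is read off from Hermitian matrices, on which A
acts by H ↦ AHA*. -/
lemma H3.trace_herm_mul_adjugate (x y : H3) :
    (x.herm * y.herm.adjugate).trace =
      (((‖x.z - y.z‖ ^ 2 + x.t ^ 2 + y.t ^ 2) / (x.t * y.t) : ℝ) : ℂ) := by
  have hx : (x.t : ℂ) ≠ 0 := by exact_mod_cast x.t_pos.ne'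
  have hy : (y.t : ℂ) ≠ 0 := by exact_mod_cast y.t_pos.ne'
  push_cast
  rw [← Complex.ofReal_pow, ← Complex.normSq_eq_norm_sq, Complex.normSq_eq_conj_mul_self]
  simp [herm, adjugate_fin_two, trace_fin_two]
  field_simp
  ring

lemma H3.hdist_move (A : SpecialLinearGroup (Fin 2) ℂ) (x y : H3) :
    (x.move A).hdist (y.move A) = x.hdist y := by
  have key : ∀ x y : H3, x.hdist y =
      Real.arcosh ((‖x.z - y.z‖ ^ 2 + x.t ^ 2 + y.t ^ 2) / (x.t * y.t) / 2) := by
    intro x y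
    have hx := x.t_pos
    have hy := y.t_pos
    unfold hdist
    congr 1
    field_simp
    ring
  rw [key, key]
  congr 2
  have h : ((x.move A).herm * (y.move A).herm.adjugate).trace =
      (x.herm * y.herm.adjugate).trace := by
    set B : Matrix (Fin 2) (Fin 2) ℂ := A.1
    have hB : B.det = 1 := A.2
    have h1 : B.adjugate * B = 1 := by rw [adjugate_mul, hB, one_smul]
    have h2 : Bᴴ * Bᴴ.adjugate = 1 := by
      rw [mul_adjugate, det_conjTranspose, hB, star_one, one_smul]
    rw [herm_move, herm_move, adjugate_mul_distrib, adjugate_mul_distrib]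
    calc (B * x.herm * Bᴴ * (Bᴴ.adjugate * (y.herm.adjugate * B.adjugate))).trace
        = (B * x.herm * (Bᴴ * Bᴴ.adjugate) * (y.herm.adjugate * B.adjugate)).trace := by
          simp only [Matrix.mul_assoc]
      _ = (B * (x.herm * y.herm.adjugate * B.adjugate)).trace := by
          rw [h2]; simp only [Matrix.mul_assoc, Matrix.mul_one]
      _ = (x.herm * y.herm.adjugate).trace := by
          rw [trace_mul_comm, Matrix.mul_assoc, h1, Matrix.mul_one]
  rw [trace_herm_mul_adjugate, trace_herm_mul_adjugate] at h
  exact_mod_cast h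

/-- The sesquilinear form on `ℂ²` attached to a point of the upper half-space, with respect to
which the end points of the geodesic lines through this point are orthogonal. -/
def H3.form (x : H3) (u v : Fin 2 → ℂ) : ℂ :=
  (u 0 - x.z * u 1) * conj (v 0 - x.z * v 1) + (x.t : ℂ) ^ 2 * (u 1 * conj (v 1))

lemma H3.form_smul_smul (x : H3) (k l : ℂ) (u v : Fin 2 → ℂ) :
    x.form (k • u) (l • v) = k * conj l * x.form u v := by
  simp [form]
  ring

/-- Up to the factor t the form is given by the inverse of `x.herm`, which is equivariant; the
denominator is the change of t. -/
lemma H3.form_move (A : SpecialLinearGroup (Fin 2) ℂ) (x : H3) (u v : Fin 2 → ℂ) :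
    (x.move A).form ((A : Matrix (Fin 2) (Fin 2) ℂ) *ᵥ u) ((A : Matrix (Fin 2) (Fin 2) ℂ) *ᵥ v) =
      x.form u v / x.denom A := by
  have hD : (x.denom A : ℂ) ≠ 0 := by exact_mod_cast (x.denom_pos A).ne'
  have hD' := x.ofReal_denom A
  have hdet := det_eq_one A
  have hcD : conj (x.denom A : ℂ) = x.denom A := Complex.conj_ofReal _
  have key : ∀ u : Fin 2 → ℂ, ((A : Matrix (Fin 2) (Fin 2) ℂ) *ᵥ u) 0 -
      (x.move A).z * ((A : Matrix (Fin 2) (Fin 2) ℂ) *ᵥ u) 1 =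
      (conj (A 1 0 * x.z + A 1 1) * (u 0 - x.z * u 1) - x.t ^ 2 * conj (A 1 0) * u 1) /
        x.denom A := by
    intro u
    simp only [move, mulVec, dotProduct, Fin.sum_univ_two, map_add, map_mul]
    field_simp
    rw [hD']
    linear_combination ((conj (A 1 0) * conj x.z + conj (A 1 1)) * (u 0 - x.z * u 1) -
      x.t ^ 2 * conj (A 1 0) * u 1) * hdet
  have key1 : ∀ u : Fin 2 → ℂ, ((A : Matrix (Fin 2) (Fin 2) ℂ) *ᵥ u) 1 =
      A 1 0 * (u 0 - x.z * u 1) + (A 1 0 * x.z + A 1 1) * u 1 := by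
    intro u
    simp only [mulVec, dotProduct, Fin.sum_univ_two]
    ring
  unfold form
  rw [key, key, key1, key1]
  simp only [move, map_div₀, map_sub, map_mul, map_add, map_pow, Complex.conj_ofReal,
    Complex.conj_conj, Complex.ofReal_div]
  field_simp
  rw [hD']
  ring

/-- Geodesic lines are defined through chosen representatives, which are equivariant only up to a
scalar; `H3.form_smul_smul` absorbs it. -/
lemma exists_smul_rep_eq (A : SpecialLinearGroup (Fin 2) ℂ) (u : P1) :
    ∃ k : ℂ, k ≠ 0 ∧ ((A : PSL2C) • u).rep = k • ((A : Matrix (Fin 2) (Fin 2) ℂ) *ᵥ u.rep) := by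
  have h : (A : PSL2C) • u = Projectivization.mk ℂ ((A : Matrix (Fin 2) (Fin 2) ℂ) *ᵥ u.rep)
      (by
        have := (smul_ne_zero_iff_ne A.toLin'_equiv).mpr u.rep_nonzero
        exact this) := by
    rw [Matrix.ProjectiveSpecialLinearGroup.smul_proj_mk,
      Projectivization.matrixSpecialLinearGroup_smul_def]
    conv_lhs => rw [← u.mk_rep]
    rfl
  obtain ⟨k, hk⟩ := (Projectivization.mk_eq_mk_iff ℂ _ _ _ _).1
    ((Projectivization.mk_rep _).trans h)
  exact ⟨k, k.ne_zero, hk.symm⟩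

lemma H3.move_mem_geodesicLine (A : SpecialLinearGroup (Fin 2) ℂ) {x : H3} {u v : P1}
    (hx : x ∈ geodesicLine u v) :
    x.move A ∈ geodesicLine ((A : PSL2C) • u) ((A : PSL2C) • v) := by
  obtain ⟨k, -, hu⟩ := exists_smul_rep_eq A u
  obtain ⟨l, -, hv⟩ := exists_smul_rep_eq A v
  change x.form u.rep v.rep = 0 at hx
  change (x.move A).form ((A : PSL2C) • u).rep ((A : PSL2C) • v).rep = 0
  rw [hu, hv, form_smul_smul, form_move, hx]
  simp

/-- Elements of `PSL(2, ℂ)` act as isometries on the upper half-space, compatibly with their action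
on axes by conjugation. -/
lemma exists_isometry (X : PSL2C) : ∃ T : H3 → H3, (∀ x y, (T x).hdist (T y) = x.hdist y) ∧
    ∀ Y, ∀ x ∈ axis Y, T x ∈ axis (X * Y * X⁻¹) := by
  obtain ⟨A, rfl⟩ := QuotientGroup.mk_surjective X
  refine ⟨H3.move A, H3.hdist_move A, ?_⟩
  rintro Y x ⟨u, v, huv, hu, hv, hx⟩
  refine ⟨(A : PSL2C) • u, (A : PSL2C) • v, fun h => huv (MulAction.injective _ h), ?_, ?_,
    H3.move_mem_geodesicLine A hx⟩
  · rw [smul_smul, inv_mul_cancel_right, mul_smul, hu]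
  · rw [smul_smul, inv_mul_cancel_right, mul_smul, hv]

end Geometry

/-! ### The three involutions attached to a basis -/

lemma lift_basis {H : Type*} [Group H] (e : F2Basis) (x : Fin 2 → H) (i : Fin 2) :
    e.lift x (e i) = x i :=
  congrFun (e.lift.symm_apply_apply x) i

lemma hom_ext {H : Type*} [Group H] (e : F2Basis) {f g : F2 →* H} (h0 : f (e 0) = g (e 0))
    (h1 : f (e 1) = g (e 1)) (w : F2) : f w = g w :=
  DFunLike.congr_fun (e.ext_hom f g (Fin.forall_fin_two.2 ⟨h0, h1⟩)) w

/-- The involution of `F2` that inverts `b` and `c`. -/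
def invP (e : F2Basis) : F2 →* F2 := e.lift ![(e 1)⁻¹ * (e 0)⁻¹ * e 1, (e 1)⁻¹]

/-- The involution of `F2` that inverts `c` and `a`. -/
def invQ (e : F2Basis) : F2 →* F2 := e.lift ![(e 0)⁻¹, e 0 * (e 1)⁻¹ * (e 0)⁻¹]

/-- The involution of `F2` that inverts `a` and `b`. -/
def invR (e : F2Basis) : F2 →* F2 := e.lift ![(e 0)⁻¹, (e 1)⁻¹]

section values

variable (e : F2Basis)

lemma invP_zero : invP e (e 0) = (e 1)⁻¹ * (e 0)⁻¹ * e 1 := lift_basis e _ 0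
lemma invP_one : invP e (e 1) = (e 1)⁻¹ := lift_basis e _ 1
lemma invQ_zero : invQ e (e 0) = (e 0)⁻¹ := lift_basis e _ 0
lemma invQ_one : invQ e (e 1) = e 0 * (e 1)⁻¹ * (e 0)⁻¹ := lift_basis e _ 1
lemma invR_zero : invR e (e 0) = (e 0)⁻¹ := lift_basis e _ 0
lemma invR_one : invR e (e 1) = (e 1)⁻¹ := lift_basis e _ 1

lemma invQ_invQ (w : F2) : invQ e (invQ e w) = w := by
  refine hom_ext e (f := (invQ e).comp (invQ e)) (g := MonoidHom.id F2) ?_ ?_ w <;>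
    simp [invQ_zero, invQ_one, mul_assoc]

lemma invR_invR (w : F2) : invR e (invR e w) = w := by
  refine hom_ext e (f := (invR e).comp (invR e)) (g := MonoidHom.id F2) ?_ ?_ w <;>
    simp [invR_zero, invR_one]

end values

/-- The intersections of the axis of `X` with the axes of the images of the primitive elements that
are inverted by `ι`. -/
def invertedSet (ρ : F2 →* PSL2C) (X : PSL2C) (ι : F2 →* F2) : Set H3 :=
  {s | ∃ w : F2, IsPrimitive w ∧ ι w = w⁻¹ ∧ s ∈ axis X ∩ axis (ρ w)}

/-- Since ι sends v(x, y) to v(x⁻¹, y⁻¹), being a palindrome means being inverted by ι; `h0` and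
`h1` ensure that every element is a word in x and y. -/
lemma intersectionSet_eq (ρ : F2 →* PSL2C) (X : PSL2C) {x y : F2} {ι : F2 →* F2}
    (hx : ι x = x⁻¹) (hy : ι y = y⁻¹) (e : F2Basis)
    (h0 : e 0 ∈ (FreeGroup.lift ![x, y]).range) (h1 : e 1 ∈ (FreeGroup.lift ![x, y]).range) :
    intersectionSet ρ X x y = invertedSet ρ X ι := by
  have hι : ∀ v, ι (FreeGroup.lift ![x, y] v) = FreeGroup.lift ![x⁻¹, y⁻¹] v := by
    intro v
    refine DFunLike.congr_fun
      (FreeGroup.ext_hom (ι.comp (FreeGroup.lift ![x, y])) _ fun i => ?_) v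
    fin_cases i <;> simp [hx, hy]
  have hsurj : ∀ w, ∃ v, FreeGroup.lift ![x, y] v = w := by
    obtain ⟨v0, hv0⟩ := h0
    obtain ⟨v1, hv1⟩ := h1
    exact fun w => ⟨_, hom_ext e (f := (FreeGroup.lift ![x, y]).comp (e.lift ![v0, v1]))
      (g := MonoidHom.id F2) (by simp [hv0]) (by simp [hv1]) w⟩
  ext s
  refine exists_congr fun w => and_congr_right fun _ => and_congr_left fun _ => ⟨?_, fun h => ?_⟩
  · rintro ⟨v, rfl, hv⟩
    rw [hι, hv]
  · obtain ⟨v, rfl⟩ := hsurj w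
    exact ⟨v, rfl, by rw [← h, hι]⟩

/-- The bounded intersection property in terms of the images of the generators of the Coxeter
group. -/
lemma hasBoundedIntersection_iff (ρ : F2 →* PSL2C) (e : F2Basis) :
    HasBoundedIntersection ρ e ↔ IsIrreducible ρ ∧
      (∀ w : F2, IsPrimitive w → IsLoxodromic (ρ w)) ∧
      ∃ P Q R : PSL2C, P⁻¹ = P ∧ Q⁻¹ = Q ∧ R⁻¹ = R ∧ ρ (e 0) = Q * R ∧ ρ (e 1) = R * P ∧
        HBounded (invertedSet ρ P (invP e)) ∧ HBounded (invertedSet ρ Q (invQ e)) ∧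
        HBounded (invertedSet ρ R (invR e)) := by
  have hP : ∀ X, intersectionSet ρ X (e 1) (third e) = invertedSet ρ X (invP e) := fun X =>
    intersectionSet_eq ρ X (invP_one e) (by simp [third, invP_zero, invP_one]) e
      ⟨(FreeGroup.of 1)⁻¹ * (FreeGroup.of 0)⁻¹, by simp [third]⟩ ⟨FreeGroup.of 0, by simp⟩
  have hQ : ∀ X, intersectionSet ρ X (third e) (e 0) = invertedSet ρ X (invQ e) := fun X =>
    intersectionSet_eq ρ X (by simp [third, invQ_zero, invQ_one, mul_assoc]) (invQ_zero e) e
      ⟨FreeGroup.of 1, by simp⟩ ⟨(FreeGroup.of 1)⁻¹ * (FreeGroup.of 0)⁻¹, by simp [third]⟩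
  have hR : ∀ X, intersectionSet ρ X (e 0) (e 1) = invertedSet ρ X (invR e) := fun X =>
    intersectionSet_eq ρ X (invR_zero e) (invR_one e) e
      ⟨FreeGroup.of 0, by simp⟩ ⟨FreeGroup.of 1, by simp⟩
  simp only [HasBoundedIntersection, hP, hQ, hR]
  refine and_congr_right fun _ => and_congr_right fun _ => ⟨?_, ?_⟩
  -- A homomorphism from W amounts to a triple of elements equal to their inverses, and its
  -- compatibility with ρ need only be tested on a and b.
  · rintro ⟨ρe, rfl, h⟩
    have hinv : ∀ i, (ρe (gen i))⁻¹ = ρe (gen i) := by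
      intro i
      have h1 : gen i * gen i = 1 := by
        rw [← sq]
        exact PresentedGroup.one_of_mem (rels := coxeterRels) ⟨i, rfl⟩
      rw [inv_eq_iff_mul_eq_one, ← map_mul, h1, map_one]
    refine ⟨_, _, _, hinv 0, hinv 1, hinv 2, ?_, ?_, h⟩ <;> simp [psi]
  · rintro ⟨P, Q, R, hP, hQ, hR, h0, h1, h⟩
    have hrel : ∀ r ∈ coxeterRels, FreeGroup.lift ![P, Q, R] r = 1 := by
      rintro _ ⟨i, rfl⟩
      fin_cases i <;> simp [sq, ← inv_eq_iff_mul_eq_one, hP, hQ, hR]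
    have hgen : ∀ i, PresentedGroup.toGroup hrel (gen i) = ![P, Q, R] i := fun i =>
      PresentedGroup.toGroup.of hrel
    refine ⟨PresentedGroup.toGroup hrel, ?_, by simpa [hgen] using h⟩
    refine MonoidHom.ext fun w => ?_
    refine hom_ext e ?_ ?_ w <;> simp [psi, hgen, h0, h1]

lemma IsPrimitive.map {w : F2} (hw : IsPrimitive w) (φ : MulAut F2) : IsPrimitive (φ w) := by
  obtain ⟨e, i, rfl⟩ := hw
  exact ⟨e.map φ, i, rfl⟩

/-- The isometry Y⁻¹ maps the new set into the old one, because κ⁻¹ takes primitive elements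
inverted by ι' to primitive elements inverted by ι. -/
lemma HBounded.invertedSet_conj {ρ : F2 →* PSL2C} {X : PSL2C} {ι : F2 →* F2}
    (h : HBounded (invertedSet ρ X ι)) {Y : PSL2C} {κ : MulAut F2}
    (hκ : ∀ w, ρ (κ w) = Y * ρ w * Y⁻¹) {ι' : F2 →* F2} (hι : ∀ w, ι' (κ w) = κ (ι w)) :
    HBounded (invertedSet ρ (Y * X * Y⁻¹) ι') := by
  obtain ⟨T, hT, hTaxis⟩ := exists_isometry Y⁻¹
  have hmem : ∀ s ∈ invertedSet ρ (Y * X * Y⁻¹) ι', T s ∈ invertedSet ρ X ι := by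
    rintro s ⟨w, hw, hinv, hsX, hsw⟩
    obtain ⟨w, rfl⟩ := κ.surjective w
    refine ⟨w, by simpa using hw.map κ⁻¹, κ.injective (by rw [← hι, hinv, map_inv]), ?_, ?_⟩
    · simpa [mul_assoc] using hTaxis _ s hsX
    · rw [hκ] at hsw
      simpa [mul_assoc] using hTaxis _ s hsw
  obtain ⟨C, hC⟩ := h
  exact ⟨C, fun p hp q hq => by rw [← hT]; exact hC _ (hmem p hp) _ (hmem q hq)⟩

/-- An involutive endomorphism as an automorphism. -/
def involution (κ : F2 →* F2) (h : ∀ w, κ (κ w) = w) : MulAut F2 :=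
  MonoidHom.toMulEquiv κ κ (MonoidHom.ext h) (MonoidHom.ext h)

@[simp] lemma involution_apply (κ : F2 →* F2) (h : ∀ w, κ (κ w) = w) (w : F2) :
    involution κ h w = κ w := rfl

/-! ### Change of basis by Nielsen moves -/

section Moves

lemma mul_mul_cancel_of_inv_eq {G : Type*} [Group G] {x : G} (hx : x⁻¹ = x) (y : G) :
    x * (x * y) = y := by
  nth_rw 1 [← hx]
  exact inv_mul_cancel_left x y

variable {ρ : F2 →* PSL2C} {e f : F2Basis} {P Q R : PSL2C}

/-- This realizes conjugation by R by an automorphism of F2, as `HBounded.invertedSet_conj`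
requires. -/
lemma map_invR (hP : P⁻¹ = P) (hQ : Q⁻¹ = Q) (hR : R⁻¹ = R) (h0 : ρ (e 0) = Q * R)
    (h1 : ρ (e 1) = R * P) (w : F2) : ρ (invR e w) = R * ρ w * R⁻¹ := by
  have hRR := mul_eq_one_iff_eq_inv.2 hR.symm
  have hR' := mul_mul_cancel_of_inv_eq hR
  refine hom_ext e (f := ρ.comp (invR e)) (g := (MulAut.conj R).toMonoidHom.comp ρ) ?_ ?_ w <;>
    simp [invR_zero, invR_one, h0, h1, hP, hQ, hR, mul_assoc, hRR, hR']

lemma map_invQ (hP : P⁻¹ = P) (hQ : Q⁻¹ = Q) (hR : R⁻¹ = R) (h0 : ρ (e 0) = Q * R)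
    (h1 : ρ (e 1) = R * P) (w : F2) : ρ (invQ e w) = Q * ρ w * Q⁻¹ := by
  have hR' := mul_mul_cancel_of_inv_eq hR
  have hQ' := mul_mul_cancel_of_inv_eq hQ
  refine hom_ext e (f := ρ.comp (invQ e)) (g := (MulAut.conj Q).toMonoidHom.comp ρ) ?_ ?_ w <;>
    simp [invQ_zero, invQ_one, h0, h1, hP, hQ, hR, mul_assoc, hR', hQ']

lemma HasBoundedIntersection.swap (h : HasBoundedIntersection ρ e) (hf0 : f 0 = e 1)
    (hf1 : f 1 = e 0) : HasBoundedIntersection ρ f := by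
  rw [hasBoundedIntersection_iff] at h ⊢
  obtain ⟨h1, h2, P, Q, R, hP, hQ, hR, he0, he1, hJP, hJQ, hJR⟩ := h
  have hκ := map_invR hP hQ hR he0 he1
  have hPf0 := invP_zero f
  have hPf1 := invP_one f
  have hQf0 := invQ_zero f
  have hQf1 := invQ_one f
  have hRf0 := invR_zero f
  have hRf1 := invR_one f
  simp only [hf0, hf1] at hPf0 hPf1 hQf0 hQf1 hRf0 hRf1
  refine ⟨h1, h2, R * Q * R⁻¹, R * P * R⁻¹, R, by simp [hQ, mul_assoc], by simp [hP, mul_assoc],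
    hR, by simp [hf0, he1], ?_, hJQ.invertedSet_conj (κ := involution _ (invR_invR e)) hκ ?_,
    hJP.invertedSet_conj (κ := involution _ (invR_invR e)) hκ ?_, ?_⟩
  · simp [hf1, he0, hR, mul_assoc, mul_mul_cancel_of_inv_eq hR]
  · refine hom_ext e (f := (invP f).comp (invR e)) (g := (invR e).comp (invQ e)) ?_ ?_ <;>
      simp [invQ_zero, invQ_one, invR_zero, invR_one, hPf0, hPf1, mul_assoc]
  · refine hom_ext e (f := (invQ f).comp (invR e)) (g := (invR e).comp (invP e)) ?_ ?_ <;>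
      simp [invP_zero, invP_one, invR_zero, invR_one, hQf0, hQf1, mul_assoc]
  · have : invR f = invR e := MonoidHom.ext (hom_ext e (by rw [hRf1, invR_zero])
      (by rw [hRf0, invR_one]))
    rwa [this]

lemma HasBoundedIntersection.inv (h : HasBoundedIntersection ρ e) (hf0 : f 0 = (e 0)⁻¹)
    (hf1 : f 1 = e 1) : HasBoundedIntersection ρ f := by
  rw [hasBoundedIntersection_iff] at h ⊢
  obtain ⟨h1, h2, P, Q, R, hP, hQ, hR, he0, he1, hJP, hJQ, hJR⟩ := h
  have hκ := map_invR hP hQ hR he0 he1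
  have hPf0 := invP_zero f
  have hPf1 := invP_one f
  have hQf0 := invQ_zero f
  have hQf1 := invQ_one f
  have hRf0 := invR_zero f
  have hRf1 := invR_one f
  simp only [hf0, hf1, map_inv, inv_inv, inv_eq_iff_eq_inv, mul_inv_rev]
    at hPf0 hPf1 hQf0 hQf1 hRf0 hRf1
  refine ⟨h1, h2, P, R * Q * R⁻¹, R, hP, by simp [hQ, mul_assoc],
    hR, by simp [hf0, he0, hR, hQ, mul_assoc, mul_eq_one_iff_eq_inv.2 hR.symm], by rw [hf1, he1], ?_,
    hJQ.invertedSet_conj (κ := involution _ (invR_invR e)) hκ ?_, ?_⟩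
  · have : invP f = invP e := MonoidHom.ext (hom_ext e (by simp [hPf0, invP_zero, mul_assoc])
      (by rw [hPf1, invP_one]))
    rwa [this]
  · refine hom_ext e (f := (invQ f).comp (invR e)) (g := (invR e).comp (invQ e)) ?_ ?_ <;>
      simp [invQ_zero, invQ_one, invR_zero, invR_one, hQf0, hQf1, mul_assoc]
  · have : invR f = invR e := MonoidHom.ext (hom_ext e (by simp [hRf0, invR_zero])
      (by rw [hRf1, invR_one]))
    rwa [this]

lemma HasBoundedIntersection.mul (h : HasBoundedIntersection ρ e) (hf0 : f 0 = e 0)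
    (hf1 : f 1 = e 0 * e 1) : HasBoundedIntersection ρ f := by
  rw [hasBoundedIntersection_iff] at h ⊢
  obtain ⟨h1, h2, P, Q, R, hP, hQ, hR, he0, he1, hJP, hJQ, hJR⟩ := h
  have hRR := mul_eq_one_iff_eq_inv.2 hR.symm
  have hκ := map_invQ hP hQ hR he0 he1
  have hPf0 := invP_zero f
  have hPf1 := invP_one f
  have hQf0 := invQ_zero f
  have hQf1 := invQ_one f
  have hRf0 := invR_zero f
  have hRf1 := invR_one f
  simp only [hf0, hf1, map_mul] at hPf0 hPf1 hQf0 hQf1 hRf0 hRf1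
  rw [hPf0, ← eq_inv_mul_iff_mul_eq] at hPf1
  rw [hQf0, ← eq_inv_mul_iff_mul_eq] at hQf1
  rw [hRf0, ← eq_inv_mul_iff_mul_eq] at hRf1
  -- For (a, ab) the old Q takes the role of R, since a = QR = (QRQ)Q and ab = QP; only the middle
  -- set has to be moved.
  refine ⟨h1, h2, P, Q * R * Q⁻¹, Q, hP, by simp [hR, mul_assoc],
    hQ, by simp [hf0, he0], ?_, ?_,
    hJR.invertedSet_conj (κ := involution _ (invQ_invQ e)) hκ ?_, ?_⟩
  · rw [hf1, map_mul, he0, he1, mul_assoc, ← mul_assoc R R, hRR, one_mul]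
  · have : invP f = invP e := MonoidHom.ext (hom_ext e (by simp [hPf0, invP_zero, mul_assoc])
      (by simp [hPf1, invP_one, mul_assoc]))
    rwa [this]
  · refine hom_ext e (f := (invQ f).comp (invQ e)) (g := (invQ e).comp (invR e)) ?_ ?_ <;>
      simp [invQ_zero, invQ_one, invR_zero, invR_one, hQf0, hQf1, mul_assoc]
  · have : invR f = invQ e := MonoidHom.ext (hom_ext e (by simp [hRf0, invQ_zero])
      (by simp [hRf1, invQ_one, mul_assoc]))
    rwa [this]

lemma HasBoundedIntersection.conj (h : HasBoundedIntersection ρ e) (g : F2)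
    (hf0 : f 0 = g * e 0 * g⁻¹) (hf1 : f 1 = g * e 1 * g⁻¹) : HasBoundedIntersection ρ f := by
  rw [hasBoundedIntersection_iff] at h ⊢
  obtain ⟨h1, h2, P, Q, R, hP, hQ, hR, he0, he1, hJP, hJQ, hJR⟩ := h
  have hκ : ∀ w, ρ (MulAut.conj g w) = ρ g * ρ w * (ρ g)⁻¹ := by simp
  have hf0' : MulAut.conj g (e 0) = f 0 := by simp [hf0]
  have hf1' : MulAut.conj g (e 1) = f 1 := by simp [hf1]
  refine ⟨h1, h2, ρ g * P * (ρ g)⁻¹, ρ g * Q * (ρ g)⁻¹, ρ g * R * (ρ g)⁻¹,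
    by simp [hP, mul_assoc], by simp [hQ, mul_assoc], by simp [hR, mul_assoc],
    by simp [hf0, he0, mul_assoc], by simp [hf1, he1, mul_assoc],
    hJP.invertedSet_conj hκ ?_, hJQ.invertedSet_conj hκ ?_, hJR.invertedSet_conj hκ ?_⟩
  · refine hom_ext e (f := (invP f).comp (MulAut.conj g).toMonoidHom)
      (g := (MulAut.conj g).toMonoidHom.comp (invP e)) ?_ ?_ <;>
      simp only [MonoidHom.comp_apply, MulEquiv.toMonoidHom_eq_coe, MonoidHom.coe_coe, hf0', hf1',
        invP_zero, invP_one, map_mul, map_inv]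
  · refine hom_ext e (f := (invQ f).comp (MulAut.conj g).toMonoidHom)
      (g := (MulAut.conj g).toMonoidHom.comp (invQ e)) ?_ ?_ <;>
      simp only [MonoidHom.comp_apply, MulEquiv.toMonoidHom_eq_coe, MonoidHom.coe_coe, hf0', hf1',
        invQ_zero, invQ_one, map_mul, map_inv]
  · refine hom_ext e (f := (invR f).comp (MulAut.conj g).toMonoidHom)
      (g := (MulAut.conj g).toMonoidHom.comp (invR e)) ?_ ?_ <;>
      simp only [MonoidHom.comp_apply, MulEquiv.toMonoidHom_eq_coe, MonoidHom.coe_coe, hf0', hf1',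
        invR_zero, invR_one, map_inv]

end Moves

/-! ### Independence of the basis -/

lemma generatesPair_basis (e : F2Basis) : GeneratesPair (e 0) (e 1) := by
  intro N h0 h1
  rw [eq_top_iff]
  intro w _
  have := hom_ext e (f := N.subtype.comp (e.lift ![⟨e 0, h0⟩, ⟨e 1, h1⟩]))
    (g := MonoidHom.id F2) (by simp) (by simp) w
  rw [MonoidHom.id_apply] at this
  rw [← this]
  exact SetLike.coe_mem _

/-- The relation of being a basis for which `ρ` has the bounded intersection property is stable
under Nielsen moves. -/
lemma nielsenClosed (ρ : F2 →* PSL2C) : NielsenClosed fun u v : F2 =>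
    ∃ f : F2Basis, f 0 = u ∧ f 1 = v ∧ HasBoundedIntersection ρ f where
  swap := by
    rintro _ _ ⟨f, rfl, rfl, h⟩
    exact ⟨f.reindex (Equiv.swap 0 1), by simp, by simp, h.swap (by simp) (by simp)⟩
  inv := by
    rintro _ _ ⟨f, rfl, rfl, h⟩
    let κ := involution (f.lift ![(f 0)⁻¹, f 1]) (hom_ext f
      (f := (f.lift ![(f 0)⁻¹, f 1]).comp (f.lift ![(f 0)⁻¹, f 1])) (g := MonoidHom.id F2)
      (by simp) (by simp))
    have h0 : f.map κ 0 = (f 0)⁻¹ := by simp [κ]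
    have h1 : f.map κ 1 = f 1 := by simp [κ]
    exact ⟨f.map κ, h0, h1, h.inv h0 h1⟩
  mul := by
    rintro _ _ ⟨f, rfl, rfl, h⟩
    let κ : MulAut F2 := MonoidHom.toMulEquiv (f.lift ![f 0, f 0 * f 1])
      (f.lift ![f 0, (f 0)⁻¹ * f 1])
      (MonoidHom.ext (hom_ext f (by simp) (by simp)))
      (MonoidHom.ext (hom_ext f (by simp) (by simp)))
    have h0 : f.map κ 0 = f 0 := by simp [κ]
    have h1 : f.map κ 1 = f 0 * f 1 := by simp [κ]
    exact ⟨f.map κ, h0, h1, h.mul h0 h1⟩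
  conj := by
    rintro g _ _ ⟨f, rfl, rfl, h⟩
    exact ⟨f.map (MulAut.conj g), by simp, by simp, h.conj g (by simp) (by simp)⟩

lemma HasBoundedIntersection.of_standard {ρ : F2 →* PSL2C}
    (h : HasBoundedIntersection ρ (FreeGroupBasis.ofFreeGroup (Fin 2))) (f : F2Basis) :
    HasBoundedIntersection ρ f := by
  obtain ⟨f', h0, h1, hf⟩ := (nielsenClosed ρ).of_generatesPair ⟨_, rfl, rfl, h⟩ f
    (generatesPair_basis f)
  have : f' = f := DFunLike.ext _ _ (Fin.forall_fin_two.2 ⟨h0, h1⟩)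
  rwa [← this]

/-- Transport of the bounded intersection property by an automorphism. -/
lemma HasBoundedIntersection.autRep {ρ : F2 →* PSL2C} {e : F2Basis}
    (h : HasBoundedIntersection ρ e) (φ : MulAut F2) :
    HasBoundedIntersection (autRep φ ρ) (e.map φ) := by
  rw [hasBoundedIntersection_iff] at h ⊢
  obtain ⟨h1, h2, P, Q, R, hP, hQ, hR, he0, he1, hJP, hJQ, hJR⟩ := h
  have happ : ∀ w, BoundedIntersection.autRep φ ρ (φ w) = ρ w := fun w =>
    congrArg ρ (MulAut.inv_apply_self _ φ w)
  have hset : ∀ {X : PSL2C} {ι ι' : F2 →* F2}, (∀ w, ι' (φ w) = φ (ι w)) →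
      invertedSet (BoundedIntersection.autRep φ ρ) X ι' ⊆ invertedSet ρ X ι := by
    rintro X ι ι' hι s ⟨w, hw, hinv, hs⟩
    obtain ⟨w, rfl⟩ := φ.surjective w
    refine ⟨w, by simpa using hw.map φ⁻¹, φ.injective (by rw [← hι, hinv, map_inv]), ?_⟩
    rwa [happ] at hs
  have hb : ∀ {X : PSL2C} {ι ι' : F2 →* F2}, HBounded (invertedSet ρ X ι) →
      (∀ w, ι' (φ w) = φ (ι w)) → HBounded (invertedSet (BoundedIntersection.autRep φ ρ) X ι') :=
    fun ⟨C, hC⟩ hι => ⟨C, fun p hp q hq => hC p (hset hι hp) q (hset hι hq)⟩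
  have hm : ∀ i, φ (e i) = e.map φ i := fun i => rfl
  refine ⟨?_, fun w hw => ?_, P, Q, R, hP, hQ, hR, ?_, ?_, hb hJP ?_, hb hJQ ?_, hb hJR ?_⟩
  · rintro ⟨u, hu⟩
    exact h1 ⟨u, fun w => by rw [← happ]; exact hu _⟩
  · obtain ⟨w, rfl⟩ := φ.surjective w
    rw [happ]
    exact h2 w (by simpa using hw.map φ⁻¹)
  · rw [← hm, happ, he0]
  · rw [← hm, happ, he1]
  · refine hom_ext e (f := (invP (e.map φ)).comp φ.toMonoidHom)
      (g := φ.toMonoidHom.comp (invP e)) ?_ ?_ <;>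
      simp only [MonoidHom.comp_apply, MulEquiv.toMonoidHom_eq_coe, MonoidHom.coe_coe, hm,
        invP_zero, invP_one, map_mul, map_inv]
  · refine hom_ext e (f := (invQ (e.map φ)).comp φ.toMonoidHom)
      (g := φ.toMonoidHom.comp (invQ e)) ?_ ?_ <;>
      simp only [MonoidHom.comp_apply, MulEquiv.toMonoidHom_eq_coe, MonoidHom.coe_coe, hm,
        invQ_zero, invQ_one, map_mul, map_inv]
  · refine hom_ext e (f := (invR (e.map φ)).comp φ.toMonoidHom)
      (g := φ.toMonoidHom.comp (invR e)) ?_ ?_ <;>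
      simp only [MonoidHom.comp_apply, MulEquiv.toMonoidHom_eq_coe, MonoidHom.coe_coe, hm,
        invR_zero, invR_one, map_inv]

/-- Nielsen moves have been followed only from the standard basis s. With φ(e) = s, the twisted
representation ρ ∘ φ⁻¹ has the property at s, hence at φ(s); twisting back by φ⁻¹ gives it for ρ at
s. -/
lemma HasBoundedIntersection.basis_change {ρ : F2 →* PSL2C} {e : F2Basis}
    (h : HasBoundedIntersection ρ e) (f : F2Basis) : HasBoundedIntersection ρ f := by
  refine of_standard ?_ f
  let φ : MulAut F2 := e.repr
  have h1 := h.autRep φ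
  have h2 : e.map φ = FreeGroupBasis.ofFreeGroup (Fin 2) :=
    DFunLike.ext _ _ fun i => e.repr_apply_coe i
  rw [h2] at h1
  have h3 := (h1.of_standard (FreeGroupBasis.map (FreeGroupBasis.ofFreeGroup (Fin 2)) φ)).autRep φ⁻¹
  have h4 : BoundedIntersection.autRep φ⁻¹ (BoundedIntersection.autRep φ ρ) = ρ :=
    MonoidHom.ext fun w => congrArg ρ (by simp)
  have h5 : FreeGroupBasis.map (FreeGroupBasis.map (FreeGroupBasis.ofFreeGroup (Fin 2)) φ) φ⁻¹ =
      FreeGroupBasis.ofFreeGroup (Fin 2) :=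
    DFunLike.ext _ _ fun i => by simp
  rwa [h4, h5] at h3

lemma smul_mem_BI (e : F2Basis) (θ : OutF2) {χ : CharacterVariety} (hχ : χ ∈ BI e) :
    θ • χ ∈ BI e := by
  obtain ⟨ρ, hρ, rfl⟩ := hχ
  obtain ⟨φ, rfl⟩ := QuotientGroup.mk_surjective θ
  exact ⟨autRep φ ρ, (hρ.autRep φ).basis_change e, rfl⟩

end BoundedIntersection

end

theorem mainTheorem5 :
    (∀ (ρ : BoundedIntersection.F2 →* BoundedIntersection.PSL2C)
      (e f : BoundedIntersection.F2Basis),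
      BoundedIntersection.HasBoundedIntersection ρ e ↔
        BoundedIntersection.HasBoundedIntersection ρ f) ∧
    (∀ (e : BoundedIntersection.F2Basis) (θ : BoundedIntersection.OutF2),
      (fun χ : BoundedIntersection.CharacterVariety => θ • χ) '' BoundedIntersection.BI e =
        BoundedIntersection.BI e) := by
  refine ⟨fun ρ e f => ⟨fun h => h.basis_change f, fun h => h.basis_change e⟩, fun e θ => ?_⟩
  refine Set.Subset.antisymm ?_ fun χ hχ => ?_
  · rintro _ ⟨χ, hχ, rfl⟩
    exact BoundedIntersection.smul_mem_BI e θ hχ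
  · exact ⟨θ⁻¹ • χ, BoundedIntersection.smul_mem_BI e θ⁻¹ hχ, smul_inv_smul θ χ⟩
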